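/- A signed graph $\Gamma=(G,\sigma)$ is a finite simple graph $G$ together with a sign function $\sigma:E(G)\to\{1,-1\}$. Its adjacency matrix $A(\Gamma)$ has the entry $\sigma(uv)$ at $(u,v)$ if $uv\in E(G)$ and $0$ otherwise, and its index $\lambda_1(\Gamma)$ is the largest eigenvalue of $A(\Gamma)$. A cycle is negative if the product of the signs of its edges is $-1$, and $\Gamma$ is unbalanced if it contains a negative cycle. Two signed graphs are switching equivalent if one is obtained, up to isomorphism, from the other by choosing $\theta:V\to\{1,-1\}$ and multiplying the sign of every edge $uv$ by $\theta(u)\theta(v)$. For $n\ge 3$ let $\Gamma_1=C_3^-\bullet K_{n-2}$ be the signed graph of order $n$ obtained from the all-positive complete graph $K_{n-2}$ and a triangle with exactly one negative edge by identifying a vertex of $K_{n-2}$ with the vertex of the triangle that is not on its negative edge. Let $\Gamma$ be an unbalanced signed graph of order $n\ge 12$ with $\lambda_1(\Gamma)\ge\lambda_1(\Gamma_1)$. Then $\Gamma$ contains a negative cycle of length $5$, unless $\Gamma$ is switching equivalent to $\Gamma_1$. -/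

import Mathlib

/-- A signed graph `Γ = (G, σ)` on the vertex set `V`: a simple graph `G` together with a
sign function `σ : E(G) → {1, -1}`. -/
structure SignedGraph (V : Type*) where
  /-- The underlying graph. -/
  graph : SimpleGraph V
  /-- The sign of each edge. -/
  sign : graph.edgeSet → ℤˣ

namespace SignedGraph

variable {V W : Type*}

/-- The sign of the edge `uv`. -/
def edgeSign (Γ : SignedGraph V) {u v : V} (h : Γ.graph.Adj u v) : ℤˣ :=
  Γ.sign ⟨s(u, v), h⟩

/-- The sign of a walk: the product of the signs of its edges, with multiplicity. -/
def walkSign (Γ : SignedGraph V) : {u v : V} → Γ.graph.Walk u v → ℤˣ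
  | _, _, .nil => 1
  | _, _, .cons h p => Γ.edgeSign h * walkSign Γ p

/-- `Γ` contains a negative (unbalanced) cycle of length `r` as a subgraph. -/
def HasNegativeCycle (Γ : SignedGraph V) (r : ℕ) : Prop :=
  ∃ (u : V) (c : Γ.graph.Walk u u), c.IsCycle ∧ c.length = r ∧ Γ.walkSign c = -1

/-- `Γ` is balanced if every cycle of `Γ` is positive. -/
def Balanced (Γ : SignedGraph V) : Prop :=
  ∀ (u : V) (c : Γ.graph.Walk u u), c.IsCycle → Γ.walkSign c = 1

open Classical in
/-- The adjacency matrix `A(Γ)`: the entry at `(u, v)` is `σ(uv)` if `u` and `v` are adjacent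
and `0` otherwise. -/
noncomputable def adjMatrix (Γ : SignedGraph V) : Matrix V V ℝ :=
  Matrix.of fun u v => if h : Γ.graph.Adj u v then (((Γ.edgeSign h : ℤˣ) : ℤ) : ℝ) else 0

/-- The index `λ₁(Γ)`: the largest eigenvalue of the adjacency matrix. (For a finite nonempty
vertex set the supremum is attained, see `isGreatest_index`.) -/
noncomputable def index [Fintype V] (Γ : SignedGraph V) : ℝ :=
  sSup {μ : ℝ | Module.End.HasEigenvalue Γ.adjMatrix.mulVecLin μ}

/-- Switching `Γ` by `θ : V → {1, -1}`: the sign of each edge `uv` is multiplied by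
`θ(u) θ(v)`. Equivalently, all edges between `{v | θ v = -1}` and its complement are
reversed. -/
def switch (Γ : SignedGraph V) (θ : V → ℤˣ) : SignedGraph V where
  graph := Γ.graph
  sign e := Sym2.lift ⟨fun u v => θ u * θ v, fun u v => mul_comm (θ u) (θ v)⟩ e.1 * Γ.sign e

/-- Signed graphs are isomorphic if there is an isomorphism of the underlying graphs that
preserves the sign of every edge. -/
def Isomorphic (Γ : SignedGraph V) (Γ' : SignedGraph W) : Prop :=
  ∃ f : Γ.graph ≃g Γ'.graph, ∀ (u v : V) (h : Γ.graph.Adj u v),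
    Γ'.edgeSign (f.map_adj_iff.mpr h) = Γ.edgeSign h

/-- Switching equivalence `Γ ∼ Γ'`, for unlabelled signed graphs: some switching of `Γ` is
isomorphic to `Γ'`. -/
def SwitchingEquiv (Γ : SignedGraph V) (Γ' : SignedGraph W) : Prop :=
  ∃ θ : V → ℤˣ, (Γ.switch θ).Isomorphic Γ'

/-- `Γ₁ = C₃⁻ • K_{n-2}` on the vertices `0, …, n-1` (meant for `3 ≤ n`). The vertices `0, 1, 2`
form the triangle `C₃⁻`, whose only negative edge is `01`; the vertices `2, …, n-1` form an
all-positive complete graph `K_{n-2}`; the two parts share the vertex `2`. -/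
def gammaOne (n : ℕ) : SignedGraph (Fin n) where
  graph :=
    { Adj := fun u v => u ≠ v ∧ ((u.val ≤ 2 ∧ v.val ≤ 2) ∨ (2 ≤ u.val ∧ 2 ≤ v.val))
      symm := ⟨fun _ _ h => ⟨h.1.symm, h.2.imp And.symm And.symm⟩⟩
      loopless := ⟨fun _ h => h.1 rfl⟩ }
  sign e := if ∀ u ∈ e.1, u.val ≤ 1 then -1 else 1

theorem adjMatrix_isHermitian (Γ : SignedGraph V) : Γ.adjMatrix.IsHermitian := by
  ext u v
  simp only [Matrix.conjTranspose_apply, adjMatrix, Matrix.of_apply, star_trivial]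
  by_cases h : Γ.graph.Adj u v
  · have e : Γ.edgeSign h.symm = Γ.edgeSign h := by
      unfold edgeSign
      congr 1
      exact Subtype.ext Sym2.eq_swap
    rw [dif_pos h, dif_pos h.symm, e]
  · rw [dif_neg h, dif_neg fun h' => h h'.symm]

/-- On a finite nonempty vertex set the index is the largest eigenvalue. -/
theorem isGreatest_index [Fintype V] [Nonempty V] (Γ : SignedGraph V) :
    IsGreatest {μ : ℝ | Module.End.HasEigenvalue Γ.adjMatrix.mulVecLin μ} Γ.index := by
  classical
  have hfin : {μ : ℝ | Module.End.HasEigenvalue Γ.adjMatrix.mulVecLin μ}.Finite :=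
    Module.End.finite_hasEigenvalue _
  have hne : {μ : ℝ | Module.End.HasEigenvalue Γ.adjMatrix.mulVecLin μ}.Nonempty := by
    obtain ⟨i⟩ := ‹Nonempty V›
    refine ⟨Γ.adjMatrix_isHermitian.eigenvalues i, ?_⟩
    refine Module.End.hasEigenvalue_of_hasEigenvector
      (x := ⇑(Γ.adjMatrix_isHermitian.eigenvectorBasis i)) ⟨?_, ?_⟩
    · rw [Module.End.mem_eigenspace_iff]
      exact Γ.adjMatrix_isHermitian.mulVec_eigenvectorBasis i
    · intro h
      apply Γ.adjMatrix_isHermitian.eigenvectorBasis.orthonormal.ne_zero i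
      ext j
      exact congrFun h j
  exact ⟨hne.csSup_mem hfin, fun μ hμ => le_csSup hfin.bddAbove hμ⟩

end SignedGraph

/-! Switch so that the index `λ` has an eigenvector `x ≥ 0` with maximum 1. A test vector gives
`λ₁(Γ₁) > n - 3`, hence `λ > n - 3`; the row of a maximal entry gives `∑ x ≥ λ + 1`. So the total
deficiency `∑ (1 - x a)` is less than 2: `x` is almost constant. Some edge `uv` is negative, as the
graph is unbalanced. Without a negative pentagon, distinct positive neighbours `a` of `u` and `c` of
`v` share no positive neighbour outside `{u, v}`, so their rows barely overlap and `a`, `c` together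
have deficiency at least 1/2 (`deficiency_pair`). Many disjoint such pairs would exceed the budget
2, while few positive neighbours make `x u`, `x v` small, which is also expensive. Hence `u` and `v`
have one common positive neighbour `w` and no other (`exists_unique_posNbr`). The matrix is then
entrywise at most that of a relabelled `Γ₁`. Since `λ ≥ λ₁(Γ₁)` and `x` has at most one zero entry,
the two matrices coincide (`adjMatrix_eq_gammaOne`). -/

/-! ### Deficiency estimates for a nearly constant eigenvector -/

open Finset in
theorem sum_one_sub_lt_two {V : Type*} [Fintype V] {x : V → ℝ} {lam : ℝ}
    (hx1 : ∀ a, x a ≤ 1) (hlam : (Fintype.card V : ℝ) - 3 < lam) (hS : lam + 1 ≤ ∑ a, x a)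
    (T : Finset V) : ∑ a ∈ T, (1 - x a) < 2 := by
  have h : ∑ a ∈ T, (1 - x a) ≤ ∑ a, (1 - x a) :=
    sum_le_sum_of_subset_of_nonneg (subset_univ _) fun a _ _ => by linarith [hx1 a]
  have h2 : ∑ a, (1 - x a) = (Fintype.card V : ℝ) - ∑ a, x a := by
    simp [sum_sub_distrib]
  linarith

/-- Positive neighbours of `a` with respect to a weight function. -/
noncomputable def posNbr {V : Type*} [Fintype V] (σ : V → V → ℝ) (a : V) : Finset V :=
  {b | σ a b = 1}

theorem mem_posNbr {V : Type*} [Fintype V] {σ : V → V → ℝ} {a b : V} :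
    b ∈ posNbr σ a ↔ σ a b = 1 := by simp [posNbr]

open Finset in
theorem sum_mul_le_sum_posNbr {V : Type*} [Fintype V] {σ : V → V → ℝ} {x : V → ℝ}
    (hval : ∀ a b, σ a b = -1 ∨ σ a b = 0 ∨ σ a b = 1) (hx0 : ∀ a, 0 ≤ x a) (a : V) :
    ∑ b, σ a b * x b ≤ ∑ b ∈ posNbr σ a, x b := by
  rw [posNbr, sum_filter]
  refine sum_le_sum fun b _ => ?_
  rcases hval a b with h | h | h <;> simp only [h] <;> norm_num
  exact hx0 b

open Finset in
theorem sum_mul_add_le_sum_posNbr {V : Type*} [Fintype V] {σ : V → V → ℝ} {x : V → ℝ}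
    (hval : ∀ a b, σ a b = -1 ∨ σ a b = 0 ∨ σ a b = 1) (hx0 : ∀ a, 0 ≤ x a) {u v : V}
    (huv : σ u v = -1) :
    ∑ b, σ u b * x b + x v ≤ ∑ b ∈ posNbr σ u, x b := by
  classical
  have h : x v = ∑ b, if b = v then x b else 0 := by simp
  rw [posNbr, sum_filter, h, ← sum_add_distrib]
  refine sum_le_sum fun b _ => ?_
  by_cases hb : b = v
  · subst hb; simp only [huv]; norm_num
  · rcases hval u b with h | h | h <;> simp only [h, hb] <;> norm_num
    exact hx0 b

open Finset in
/-- Two vertices whose common positive neighbours all lie in `{u, v}` have a large total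
deficiency. -/
theorem deficiency_pair {V : Type*} [Fintype V] {σ : V → V → ℝ} {x : V → ℝ} {lam : ℝ}
    (hval : ∀ a b, σ a b = -1 ∨ σ a b = 0 ∨ σ a b = 1)
    (hx0 : ∀ a, 0 ≤ x a) (hx1 : ∀ a, x a ≤ 1) (hn : 12 ≤ Fintype.card V)
    (hlam : (Fintype.card V : ℝ) - 3 < lam)
    (heig : ∀ a, ∑ b, σ a b * x b = lam * x a)
    {u v a c : V} (huv : u ≠ v) (hac : a ≠ c) (hau : a ≠ u) (hav : a ≠ v) (hcu : c ≠ u)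
    (hcv : c ≠ v) (hcommon : ∀ b, σ a b = 1 → σ c b = 1 → b = u ∨ b = v) :
    1 / 2 + ((1 - x u) + (1 - x v)) / 4 ≤ (1 - x a) + (1 - x c) := by
  classical
  have ha := sum_mul_le_sum_posNbr hval hx0 a
  have hc := sum_mul_le_sum_posNbr hval hx0 c
  rw [heig] at ha hc
  have hui := sum_union_inter (s₁ := posNbr σ a) (s₂ := posNbr σ c) (f := x)
  have hU : ∑ b ∈ posNbr σ a ∪ posNbr σ c, x b ≤ ∑ b, x b :=
    sum_le_sum_of_subset_of_nonneg (subset_univ _) fun b _ _ => hx0 b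
  have hI : ∑ b ∈ posNbr σ a ∩ posNbr σ c, x b ≤ x u + x v := by
    rw [← sum_pair huv]
    refine sum_le_sum_of_subset_of_nonneg (fun b hb => ?_) fun b _ _ => hx0 b
    rw [mem_inter, mem_posNbr, mem_posNbr] at hb
    simpa using hcommon b hb.1 hb.2
  have hD : (1 - x u) + (1 - x v) + (1 - x a) + (1 - x c) ≤ ∑ b, (1 - x b) := by
    have : ∑ b ∈ ({u, v, a, c} : Finset V), (1 - x b) ≤ ∑ b, (1 - x b) :=
      sum_le_sum_of_subset_of_nonneg (subset_univ _) fun b _ _ => by linarith [hx1 b]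
    rw [sum_insert (by simp [huv, hau.symm, hcu.symm]), sum_insert (by simp [hav.symm, hcv.symm]),
      sum_pair hac] at this
    linarith
  have hS : ∑ b, (1 - x b) = (Fintype.card V : ℝ) - ∑ b, x b := by simp [sum_sub_distrib]
  have hn' : (12 : ℝ) ≤ Fintype.card V := by exact_mod_cast hn
  have h1 : ((Fintype.card V : ℝ) - 3) * (x a + x c) ≤ lam * (x a + x c) :=
    mul_le_mul_of_nonneg_right hlam.le (by linarith [hx0 a, hx0 c])
  -- With `δ` the deficiency of `a, c` and `s` that of `u, v`, the bounds give `(n - 4) δ ≥ n - 8 +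
  -- 2 s`. The right side exceeds `(n - 4) (1/2 + s/4)` by `(n - 12) (x u + x v) / 4`, so the
  -- constants are those of `n = 12`.
  nlinarith [hx0 u, hx0 v, mul_nonneg (sub_nonneg.2 hn') (add_nonneg (hx0 u) (hx0 v))]

-- Sum the bound over all of `A × C`: each element is counted `k` times.
open Finset in
theorem deficiency_packing {V : Type*} {d : V → ℝ} {t : ℝ} {A C : Finset V} {k : ℕ}
    (hA : A.card = k) (hC : C.card = k) (h : ∀ a ∈ A, ∀ c ∈ C, t ≤ d a + d c) :
    k * t ≤ ∑ a ∈ A, d a + ∑ c ∈ C, d c := by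
  rcases Nat.eq_zero_or_pos k with rfl | hk
  · simp [card_eq_zero.1 hA, card_eq_zero.1 hC]
  have h1 : ∑ a ∈ A, ∑ c ∈ C, t ≤ ∑ a ∈ A, ∑ c ∈ C, (d a + d c) :=
    sum_le_sum fun a ha => sum_le_sum fun c hc => h a ha c hc
  simp only [sum_add_distrib, sum_const, hA, hC, nsmul_eq_mul, ← mul_sum] at h1
  have hk' : (0 : ℝ) < k := by exact_mod_cast hk
  nlinarith

open Finset in
/-- The endpoints of a negative edge not lying on a negative pentagon have at most
one positive neighbour between them. -/
theorem eq_of_mem_posNbr {V : Type*} [Fintype V] {σ : V → V → ℝ} {x : V → ℝ} {lam : ℝ}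
    (hval : ∀ a b, σ a b = -1 ∨ σ a b = 0 ∨ σ a b = 1) (hsymm : ∀ a b, σ a b = σ b a)
    (hdiag : ∀ a, σ a a = 0)
    (hx0 : ∀ a, 0 ≤ x a) (hx1 : ∀ a, x a ≤ 1) (hn : 12 ≤ Fintype.card V)
    (hlam : (Fintype.card V : ℝ) - 3 < lam) (hS : lam + 1 ≤ ∑ a, x a)
    (heig : ∀ a, ∑ b, σ a b * x b = lam * x a)
    {u v : V} (huv : σ u v = -1)
    (hpent : ∀ a b c, a ≠ c → b ≠ u → b ≠ v → σ u a = 1 → σ a b = 1 → σ b c = 1 →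
      σ c v = 1 → False)
    (hle : (posNbr σ v).card ≤ (posNbr σ u).card)
    (hne : (posNbr σ v).Nonempty) :
    ∀ a ∈ posNbr σ u, ∀ c ∈ posNbr σ v, a = c := by
  classical
  intro a₀ ha₀ c₀ hc₀
  by_contra hac₀
  have hvu : σ v u = -1 := by rw [hsymm, huv]
  have huv' : u ≠ v := by rintro rfl; rw [hdiag] at huv; norm_num at huv
  have hn' : (12 : ℝ) ≤ Fintype.card V := by exact_mod_cast hn
  have hun : ∀ a ∈ posNbr σ u, a ≠ u ∧ a ≠ v := by
    intro a ha
    rw [mem_posNbr] at ha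
    constructor <;> rintro rfl
    · rw [hdiag] at ha; norm_num at ha
    · rw [huv] at ha; norm_num at ha
  have hvn : ∀ a ∈ posNbr σ v, a ≠ u ∧ a ≠ v := by
    intro a ha
    rw [mem_posNbr] at ha
    constructor <;> rintro rfl
    · rw [hvu] at ha; norm_num at ha
    · rw [hdiag] at ha; norm_num at ha
  set s := (1 - x u) + (1 - x v) with hs
  have hpair : ∀ a ∈ posNbr σ u, ∀ c ∈ posNbr σ v, a ≠ c →
      1 / 2 + s / 4 ≤ (1 - x a) + (1 - x c) := by
    intro a ha c hc hac
    refine deficiency_pair hval hx0 hx1 hn hlam heig huv' hac (hun a ha).1 (hun a ha).2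
      (hvn c hc).1 (hvn c hc).2 fun b hab hcb => ?_
    by_contra! hb
    rw [mem_posNbr] at ha hc
    exact hpent a b c hac hb.1 hb.2 ha hab (by rw [hsymm, hcb]) (by rw [hsymm, hc])
  have hD : ∀ T : Finset V, u ∉ T → v ∉ T → s + ∑ a ∈ T, (1 - x a) < 2 := by
    intro T hu hv
    have := sum_one_sub_lt_two hx1 hlam hS (insert u (insert v T))
    rw [sum_insert (by simp [huv', hu]), sum_insert hv] at this
    linarith
  have hsum : ∀ w, ∑ b ∈ posNbr σ w, x b ≤ (posNbr σ w).card := fun w => by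
    simpa using sum_le_card_nsmul (posNbr σ w) x 1 fun b _ => hx1 b
  have hU := (sum_mul_add_le_sum_posNbr hval hx0 huv)
  have hV := (sum_mul_add_le_sum_posNbr hval hx0 hvu)
  rw [heig] at hU hV
  -- The 9 is `12 - 3`, a lower bound for `lam`.
  have hU9 : 9 * x u + x v ≤ (posNbr σ u).card := by
    nlinarith [hx0 u, hsum u]
  have hV9 : 9 * x v + x u ≤ (posNbr σ v).card := by
    nlinarith [hx0 v, hsum v]
  -- The factor 2 leaves `k` positive neighbours of `u` outside the `k` chosen for `v`.
  have hpack : ∀ k, k ≤ (posNbr σ v).card → 2 * k ≤ (posNbr σ u).card →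
      s + k * (1 / 2 + s / 4) < 2 := by
    intro k hkv hku
    obtain ⟨C, hCs, hC⟩ := exists_subset_card_eq hkv
    have : k ≤ (posNbr σ u \ C).card := by
      have := le_card_sdiff C (posNbr σ u)
      omega
    obtain ⟨A, hAs, hA⟩ := exists_subset_card_eq this
    have hdisj : Disjoint A C := by
      rw [disjoint_left]
      intro b hb
      exact (mem_sdiff.1 (hAs hb)).2
    have h1 := deficiency_packing (d := fun a => 1 - x a) (t := 1 / 2 + s / 4) hA hC
      fun a ha c hc => hpair a (mem_sdiff.1 (hAs ha)).1 c (hCs hc)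
        fun h => (mem_sdiff.1 (hAs ha)).2 (h ▸ hc)
    rw [← sum_union hdisj] at h1
    have h2 := hD (A ∪ C)
      (fun h => (mem_union.1 h).elim (fun h => (hun u (mem_sdiff.1 (hAs h)).1).1 rfl)
        fun h => (hvn u (hCs h)).1 rfl)
      (fun h => (mem_union.1 h).elim (fun h => (hun v (mem_sdiff.1 (hAs h)).1).2 rfl)
        fun h => (hvn v (hCs h)).2 rfl)
    linarith
  have hs1 : s + (1 / 2 + s / 4) < 2 := by
    have h1 := hpair a₀ ha₀ c₀ hc₀ hac₀
    have h2 := hD {a₀, c₀} (by simp [(hun _ ha₀).1.symm, (hvn _ hc₀).1.symm])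
      (by simp [(hun _ ha₀).2.symm, (hvn _ hc₀).2.symm])
    rw [sum_pair hac₀] at h2
    linarith
  have hcard : 8 < (posNbr σ u).card + (posNbr σ v).card := by
    have : (8 : ℝ) < (posNbr σ u).card + (posNbr σ v).card := by linarith
    exact_mod_cast this
  -- If `c₀` is the only positive neighbour of `v`, then `9 * x v + x u ≤ x c₀` forces `s ≥ 1 + (1 -
  -- x c₀)`, and pairing `c₀` with three neighbours of `u` breaks the budget.
  rcases Nat.lt_or_ge (posNbr σ v).card 2 with h | h2
  · have h1 : (posNbr σ v).card = 1 := by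
      have := hne.card_pos
      omega
    have hsing : posNbr σ v = {c₀} := by
      obtain ⟨c, hc⟩ := card_eq_one.1 h1
      rw [hc, mem_singleton] at hc₀
      rw [hc, hc₀]
    rw [hsing, sum_singleton] at hV
    have h3 : 3 ≤ ((posNbr σ u).erase c₀).card := by
      have := pred_card_le_card_erase (s := posNbr σ u) (a := c₀)
      omega
    obtain ⟨A, hAs, hA⟩ := exists_subset_card_eq h3
    have h4 : ∑ a ∈ A, (1 / 2 + s / 4 - (1 - x c₀)) ≤ ∑ a ∈ A, (1 - x a) :=
      sum_le_sum fun a ha => by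
        have := mem_erase.1 (hAs ha)
        linarith [hpair a this.2 c₀ hc₀ this.1]
    rw [sum_const, hA, nsmul_eq_mul] at h4
    have hcA : c₀ ∉ A := fun h => (mem_erase.1 (hAs h)).1 rfl
    have h5 := hD (insert c₀ A)
      (fun h => (mem_insert.1 h).elim (fun h => (hvn _ hc₀).1 h.symm)
        fun h => (hun u (mem_erase.1 (hAs h)).2).1 rfl)
      (fun h => (mem_insert.1 h).elim (fun h => (hvn _ hc₀).2 h.symm)
        fun h => (hun v (mem_erase.1 (hAs h)).2).2 rfl)
    rw [sum_insert hcA] at h5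
    have h6 : 9 * x v + x u ≤ x c₀ := by nlinarith [hx0 v]
    have := hx0 v
    have := hx0 u
    have := hx1 c₀
    push_cast at h4
    linarith
  -- Bootstrap: packing `k` pairs bounds `s`, which enlarges both neighbourhoods and allows a larger
  -- `k`. The bounds are `s < 2/3`, `s < 2/7`, and for `k = 4` the absurd `s < 0`.
  · have p2 := hpack 2 h2 (by omega)
    push_cast at p2
    have hv4 : 3 < (posNbr σ v).card := by
      have : (3 : ℝ) < (posNbr σ v).card := by linarith [hx1 u, hx1 v]
      exact_mod_cast this
    have hu7 : 13 < (posNbr σ u).card + (posNbr σ v).card := by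
      have : (13 : ℝ) < (posNbr σ u).card + (posNbr σ v).card := by linarith
      exact_mod_cast this
    have p3 := hpack 3 (by omega) (by omega)
    push_cast at p3
    have hv8 : 7 < (posNbr σ v).card := by
      have : (7 : ℝ) < (posNbr σ v).card := by linarith [hx1 u, hx1 v]
      exact_mod_cast this
    have p4 := hpack 4 (by omega) (by omega)
    push_cast at p4
    linarith [hx1 u, hx1 v]

-- Otherwise `lam * x u + x v ≤ 0`, so both entries vanish, against `hpos`.
open Finset in
theorem posNbr_nonempty {V : Type*} [Fintype V] {σ : V → V → ℝ} {x : V → ℝ} {lam : ℝ}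
    (hval : ∀ a b, σ a b = -1 ∨ σ a b = 0 ∨ σ a b = 1)
    (hx0 : ∀ a, 0 ≤ x a) (hlam0 : 0 < lam)
    (hpos : ∀ a b, a ≠ b → 0 < x a + x b)
    (heig : ∀ a, ∑ b, σ a b * x b = lam * x a)
    {u v : V} (hne : u ≠ v) (huv : σ u v = -1) : (posNbr σ u).Nonempty := by
  rw [nonempty_iff_ne_empty]
  intro h
  have h1 := sum_mul_add_le_sum_posNbr hval hx0 huv
  rw [heig, h, sum_empty] at h1
  nlinarith [hx0 u, hx0 v, hpos u v hne, mul_nonneg hlam0.le (hx0 u)]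

/-- The endpoints of a negative edge not lying on a negative pentagon have a single positive
neighbour in common, and no other positive neighbours. -/
theorem exists_unique_posNbr {V : Type*} [Fintype V] {σ : V → V → ℝ} {x : V → ℝ} {lam : ℝ}
    (hval : ∀ a b, σ a b = -1 ∨ σ a b = 0 ∨ σ a b = 1) (hsymm : ∀ a b, σ a b = σ b a)
    (hdiag : ∀ a, σ a a = 0)
    (hx0 : ∀ a, 0 ≤ x a) (hx1 : ∀ a, x a ≤ 1) (hn : 12 ≤ Fintype.card V)
    (hlam : (Fintype.card V : ℝ) - 3 < lam) (hS : lam + 1 ≤ ∑ a, x a)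
    (hpos : ∀ a b, a ≠ b → 0 < x a + x b)
    (heig : ∀ a, ∑ b, σ a b * x b = lam * x a)
    {u v : V} (huv : σ u v = -1)
    (hpent : ∀ a b c, a ≠ c → b ≠ u → b ≠ v → σ u a = 1 → σ a b = 1 → σ b c = 1 →
      σ c v = 1 → False) :
    ∃ w, posNbr σ u = {w} ∧ posNbr σ v = {w} := by
  have hvu : σ v u = -1 := by rw [hsymm, huv]
  have hne : u ≠ v := by rintro rfl; rw [hdiag] at huv; norm_num at huv
  have hn' : (12 : ℝ) ≤ Fintype.card V := by exact_mod_cast hn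
  have hu := posNbr_nonempty hval hx0 (by linarith) hpos heig hne huv
  have hv := posNbr_nonempty hval hx0 (by linarith) hpos heig hne.symm hvu
  have key : ∀ a ∈ posNbr σ u, ∀ c ∈ posNbr σ v, a = c := by
    rcases le_total (posNbr σ v).card (posNbr σ u).card with h | h
    · exact eq_of_mem_posNbr hval hsymm hdiag hx0 hx1 hn hlam hS heig huv hpent h hv
    -- Exchange `u` and `v`, reading the positive path backwards.
    · intro a ha c hc
      refine (eq_of_mem_posNbr hval hsymm hdiag hx0 hx1 hn hlam hS heig hvu
        (fun a b c hac hbv hbu h1 h2 h3 h4 => ?_) h hu c hc a ha).symm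
      exact hpent c b a hac.symm hbu hbv (by rw [hsymm, h4]) (by rw [hsymm, h3])
        (by rw [hsymm, h2]) (by rw [hsymm, h1])
  obtain ⟨w, hw⟩ := hu
  obtain ⟨w', hw'⟩ := hv
  have hww := key w hw w' hw'
  subst hww
  refine ⟨w, ?_, ?_⟩
  · ext a
    rw [Finset.mem_singleton]
    exact ⟨fun h => key a h w hw', fun h => h ▸ hw⟩
  · ext a
    rw [Finset.mem_singleton]
    exact ⟨fun h => (key w hw a h).symm, fun h => h ▸ hw'⟩

/-! ### Matrix entries, switching and negative cycles -/

namespace SignedGraph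

variable {V W : Type*}

theorem adjMatrix_of_adj (Γ : SignedGraph V) {u v : V} (h : Γ.graph.Adj u v) :
    Γ.adjMatrix u v = ((Γ.edgeSign h : ℤ) : ℝ) := by
  simp [adjMatrix, h]

theorem adjMatrix_of_not_adj (Γ : SignedGraph V) {u v : V} (h : ¬ Γ.graph.Adj u v) :
    Γ.adjMatrix u v = 0 := by
  simp [adjMatrix, h]

theorem adjMatrix_symm (Γ : SignedGraph V) (u v : V) : Γ.adjMatrix u v = Γ.adjMatrix v u := by
  simpa using (Γ.adjMatrix_isHermitian.apply u v).symm

theorem adjMatrix_diag (Γ : SignedGraph V) (u : V) : Γ.adjMatrix u u = 0 :=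
  Γ.adjMatrix_of_not_adj (Γ.graph.irrefl)

theorem adjMatrix_mem (Γ : SignedGraph V) (u v : V) :
    Γ.adjMatrix u v = -1 ∨ Γ.adjMatrix u v = 0 ∨ Γ.adjMatrix u v = 1 := by
  by_cases h : Γ.graph.Adj u v
  · rw [Γ.adjMatrix_of_adj h]
    rcases Int.units_eq_one_or (Γ.edgeSign h) with h | h <;> simp [h]
  · exact Or.inr (Or.inl (Γ.adjMatrix_of_not_adj h))

theorem exists_edgeSign_of_adjMatrix {Γ : SignedGraph V} {u v : V} {s : ℤˣ}
    (h : Γ.adjMatrix u v = ((s : ℤ) : ℝ)) : ∃ h : Γ.graph.Adj u v, Γ.edgeSign h = s := by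
  by_cases h' : Γ.graph.Adj u v
  · rw [Γ.adjMatrix_of_adj h'] at h
    exact ⟨h', Units.ext (by exact_mod_cast h)⟩
  · rw [Γ.adjMatrix_of_not_adj h'] at h
    rcases Int.units_eq_one_or s with h | h <;> simp_all

theorem edgeSign_switch (Γ : SignedGraph V) (θ : V → ℤˣ) {u v : V} (h : Γ.graph.Adj u v) :
    (Γ.switch θ).edgeSign (u := u) (v := v) h = θ u * θ v * Γ.edgeSign h := rfl

theorem adjMatrix_switch (Γ : SignedGraph V) (θ : V → ℤˣ) (u v : V) :
    (Γ.switch θ).adjMatrix u v = ((θ u : ℤ) : ℝ) * ((θ v : ℤ) : ℝ) * Γ.adjMatrix u v := by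
  by_cases h : Γ.graph.Adj u v
  · rw [Γ.adjMatrix_of_adj h, (Γ.switch θ).adjMatrix_of_adj (u := u) (v := v) h,
      Γ.edgeSign_switch]
    push_cast
    rfl
  · rw [Γ.adjMatrix_of_not_adj h, (Γ.switch θ).adjMatrix_of_not_adj (u := u) (v := v) h, mul_zero]

theorem walkSign_switch (Γ : SignedGraph V) (θ : V → ℤˣ) {u v : V} (p : Γ.graph.Walk u v) :
    (Γ.switch θ).walkSign (u := u) (v := v) p = θ u * θ v * Γ.walkSign p := by
  induction p with
  | nil => exact (Int.units_mul_self _).symm ▸ rfl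
  | @cons a b c h p ih =>
    change (Γ.switch θ).edgeSign (u := a) (v := b) h * (Γ.switch θ).walkSign (u := b) (v := c) p
      = θ a * θ c * (Γ.edgeSign h * Γ.walkSign p)
    rw [ih, Γ.edgeSign_switch]
    calc θ a * θ b * Γ.edgeSign h * (θ b * θ c * Γ.walkSign p)
        = (θ b * θ b) * (θ a * θ c * (Γ.edgeSign h * Γ.walkSign p)) := by ac_rfl
      _ = _ := by rw [Int.units_mul_self, one_mul]

theorem walkSign_switch_closed (Γ : SignedGraph V) (θ : V → ℤˣ) {u : V}
    (p : Γ.graph.Walk u u) : (Γ.switch θ).walkSign (u := u) (v := u) p = Γ.walkSign p := by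
  rw [walkSign_switch, Int.units_mul_self, one_mul]

theorem HasNegativeCycle.of_switch {Γ : SignedGraph V} {θ : V → ℤˣ} {r : ℕ}
    (h : (Γ.switch θ).HasNegativeCycle r) : Γ.HasNegativeCycle r := by
  obtain ⟨u, c, hc, hr, hs⟩ := h
  exact ⟨u, c, hc, hr, (Γ.walkSign_switch_closed θ c).symm.trans hs⟩

theorem Balanced.of_switch {Γ : SignedGraph V} {θ : V → ℤˣ} (h : (Γ.switch θ).Balanced) :
    Γ.Balanced :=
  fun u c hc => (Γ.walkSign_switch_closed θ c).symm.trans (h u c hc)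

theorem balanced_of_forall_edgeSign {Γ : SignedGraph V}
    (h : ∀ u v (h : Γ.graph.Adj u v), Γ.edgeSign h = 1) : Γ.Balanced := by
  have key : ∀ {u v : V} (p : Γ.graph.Walk u v), Γ.walkSign p = 1 := by
    intro u v p
    induction p with
    | nil => rfl
    | cons e p ih => rw [walkSign, ih, h, one_mul]
  exact fun u c _ => key c

theorem exists_adjMatrix_eq_neg_one {Γ : SignedGraph V} (h : ¬ Γ.Balanced) :
    ∃ u v, Γ.adjMatrix u v = -1 := by
  by_contra! hne
  refine h (balanced_of_forall_edgeSign fun u v e => ?_)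
  refine (Int.units_eq_one_or _).resolve_right fun hs => hne u v ?_
  rw [Γ.adjMatrix_of_adj e, hs]
  norm_num

/-- A negative edge and a positive path of length four between its ends form a negative
pentagon. -/
theorem hasNegativeCycle_five {Γ : SignedGraph V} {u v a b c : V} (huv : Γ.adjMatrix u v = -1)
    (hac : a ≠ c) (hbu : b ≠ u) (hbv : b ≠ v) (hua : Γ.adjMatrix u a = 1)
    (hab : Γ.adjMatrix a b = 1) (hbc : Γ.adjMatrix b c = 1) (hcv : Γ.adjMatrix c v = 1) :
    Γ.HasNegativeCycle 5 := by
  have hcu : c ≠ u := by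
    rintro rfl
    rw [huv] at hcv
    norm_num at hcv
  have hav : a ≠ v := by
    rintro rfl
    rw [huv] at hua
    norm_num at hua
  rw [adjMatrix_symm] at huv
  obtain ⟨e, he⟩ := exists_edgeSign_of_adjMatrix (s := -1) (by simpa using huv)
  obtain ⟨e₁, h₁⟩ := exists_edgeSign_of_adjMatrix (s := 1) (by simpa using hua)
  obtain ⟨e₂, h₂⟩ := exists_edgeSign_of_adjMatrix (s := 1) (by simpa using hab)
  obtain ⟨e₃, h₃⟩ := exists_edgeSign_of_adjMatrix (s := 1) (by simpa using hbc)
  obtain ⟨e₄, h₄⟩ := exists_edgeSign_of_adjMatrix (s := 1) (by simpa using hcv)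
  refine ⟨v, .cons e (.cons e₁ (.cons e₂ (.cons e₃ (.cons e₄ .nil)))), ?_, rfl, ?_⟩
  · rw [SimpleGraph.Walk.cons_isCycle_iff]
    have := e.ne
    have := e₁.ne
    have := e₂.ne
    have := e₃.ne
    have := e₄.ne
    constructor
    · simp only [SimpleGraph.Walk.cons_isPath_iff, SimpleGraph.Walk.support_cons,
        SimpleGraph.Walk.support_nil, List.mem_cons, List.not_mem_nil]
      simp only [SimpleGraph.Walk.IsPath.nil, true_and, or_false]
      grind
    · simp only [SimpleGraph.Walk.edges_cons, SimpleGraph.Walk.edges_nil, List.mem_cons,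
        List.not_mem_nil, Sym2.eq_iff]
      grind
  · simp [walkSign, he, h₁, h₂, h₃, h₄]

/-! ### Variational description of the index -/

theorem posSemidef_index_sub [Fintype V] [DecidableEq V] [Nonempty V] (Γ : SignedGraph V) :
    (Γ.index • (1 : Matrix V V ℝ) - Γ.adjMatrix).PosSemidef := by
  have hH : (Γ.index • (1 : Matrix V V ℝ) - Γ.adjMatrix).IsHermitian :=
    (Matrix.isHermitian_one.smul (IsSelfAdjoint.all _)).sub Γ.adjMatrix_isHermitian
  rw [hH.posSemidef_iff_eigenvalues_nonneg]
  intro i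
  have h1 := hH.mulVec_eigenvectorBasis i
  rw [Matrix.sub_mulVec, Matrix.smul_mulVec, Matrix.one_mulVec] at h1
  have h2 : Module.End.HasEigenvalue Γ.adjMatrix.mulVecLin (Γ.index - hH.eigenvalues i) := by
    refine Module.End.hasEigenvalue_of_hasEigenvector
      (x := ⇑(hH.eigenvectorBasis i)) ⟨?_, ?_⟩
    · rw [Module.End.mem_eigenspace_iff, Matrix.mulVecLin_apply, sub_smul]
      rw [← h1]
      simp
    · intro h
      apply hH.eigenvectorBasis.orthonormal.ne_zero i
      ext j
      exact congrFun h j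
  have := Γ.isGreatest_index.2 h2
  simp only [Pi.zero_apply]
  linarith

theorem dotProduct_index_sub [Fintype V] [DecidableEq V] (Γ : SignedGraph V) (z : V → ℝ) :
    star z ⬝ᵥ ((Γ.index • (1 : Matrix V V ℝ) - Γ.adjMatrix).mulVec z) =
      ∑ i, z i * (Γ.index * z i - ∑ j, Γ.adjMatrix i j * z j) := by
  rw [Matrix.sub_mulVec, Matrix.smul_mulVec, Matrix.one_mulVec]
  simp only [dotProduct, Pi.star_apply, star_trivial, Pi.sub_apply, Pi.smul_apply, smul_eq_mul,
    Matrix.mulVec]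

theorem sum_index_sub_nonneg [Fintype V] [Nonempty V] (Γ : SignedGraph V) (z : V → ℝ) :
    0 ≤ ∑ i, z i * (Γ.index * z i - ∑ j, Γ.adjMatrix i j * z j) := by
  classical
  rw [← dotProduct_index_sub]
  exact Γ.posSemidef_index_sub.dotProduct_mulVec_nonneg z

/-- A positive semidefinite form vanishes only on the kernel of its matrix. -/
theorem eigen_of_sum_index_sub_nonpos [Fintype V] [Nonempty V] (Γ : SignedGraph V) {z : V → ℝ}
    (h : ∑ i, z i * (Γ.index * z i - ∑ j, Γ.adjMatrix i j * z j) ≤ 0) (i : V) :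
    ∑ j, Γ.adjMatrix i j * z j = Γ.index * z i := by
  classical
  have h0 := le_antisymm h (Γ.sum_index_sub_nonneg z)
  rw [← dotProduct_index_sub, Γ.posSemidef_index_sub.dotProduct_mulVec_zero_iff] at h0
  rw [Matrix.sub_mulVec, Matrix.smul_mulVec, Matrix.one_mulVec] at h0
  have := congrFun h0 i
  simp only [dotProduct, Pi.sub_apply, Pi.smul_apply, smul_eq_mul, Matrix.mulVec,
    Pi.zero_apply] at this
  linarith

/-! ### The matrix and index of `Γ₁` -/

theorem gammaOne_adjMatrix (n : ℕ) (i j : Fin n) :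
    (gammaOne n).adjMatrix i j =
      if i = j then 0 else if i.val ≤ 1 ∧ j.val ≤ 1 then -1
      else if (i.val ≤ 2 ∧ j.val ≤ 2) ∨ (2 ≤ i.val ∧ 2 ≤ j.val) then 1 else 0 := by
  by_cases h : (gammaOne n).graph.Adj i j
  · rw [adjMatrix_of_adj _ h]
    have h' : i ≠ j ∧ ((i.val ≤ 2 ∧ j.val ≤ 2) ∨ (2 ≤ i.val ∧ 2 ≤ j.val)) := h
    rw [if_neg h'.1, if_pos h'.2]
    have : (gammaOne n).edgeSign h = if i.val ≤ 1 ∧ j.val ≤ 1 then -1 else 1 := by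
      simp [edgeSign, gammaOne]
    rw [this]
    split_ifs <;> simp
  · rw [adjMatrix_of_not_adj _ h]
    have h' : ¬ (i ≠ j ∧ ((i.val ≤ 2 ∧ j.val ≤ 2) ∨ (2 ≤ i.val ∧ 2 ≤ j.val))) := h
    split_ifs with h1 h2 h3
    · rfl
    · exact absurd ⟨h1, Or.inl ⟨by omega, by omega⟩⟩ h'
    · exact absurd ⟨h1, h3⟩ h'
    · rfl

theorem lt_index_gammaOne {n : ℕ} (hn : 3 ≤ n) : (n : ℝ) - 3 < (gammaOne n).index := by
  obtain ⟨m, rfl⟩ := Nat.exists_eq_add_of_le' hn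
  -- For the vector with entries `t, t, 1, …, 1`, `zᵀAz - m zᵀz = 4t - 2(m + 1)t²`; this `t`
  -- maximizes it, with value `2t > 0`.
  set t : ℝ := 1 / ((m : ℝ) + 1) with ht
  have h2 : ∀ k : ℕ, ¬ k + 1 + 1 + 1 = 2 := by omega
  have h2' : ∀ k : ℕ, ¬ 2 = k + 1 + 1 + 1 := by omega
  have hrow : ∀ i : Fin (m + 3),
      ∑ j, (gammaOne (m + 3)).adjMatrix i j * (if j.val ≤ 1 then t else 1) =
        if i.val ≤ 1 then 1 - t else if i.val = 2 then m + 2 * t else (m : ℝ) := by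
    intro i
    simp only [Fin.sum_univ_succ, gammaOne_adjMatrix, Fin.ext_iff, Fin.val_succ, Fin.val_zero]
    refine Fin.cases ?_ (fun i => Fin.cases ?_ (fun i => Fin.cases ?_ (fun i => ?_) i) i) i
    · norm_num
      ring
    · norm_num
      ring
    · simp only [Fin.val_succ, Fin.val_zero]
      norm_num [h2']
      ring
    · have h : ∑ j : Fin m, (if i = j then (0 : ℝ) else 1) = m - 1 := by
        have : ∀ j : Fin m, (if i = j then (0 : ℝ) else 1) = 1 - if i = j then 1 else 0 := by
          intro j; split_ifs <;> norm_num
        simp [this]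
      norm_num [← Fin.ext_iff, h, h2]
  have h := (gammaOne (m + 3)).sum_index_sub_nonneg (fun i => if i.val ≤ 1 then t else 1)
  simp only [hrow] at h
  simp only [Fin.sum_univ_succ, Fin.val_succ, Fin.val_zero] at h
  norm_num [h2] at h
  have hm : (0 : ℝ) < (m : ℝ) + 1 := by positivity
  have ht0 : 0 < t := by positivity
  have htm : t * (m + 1) = 1 := by rw [ht]; field_simp
  push_cast
  by_contra! hle
  have h3 : (m + 1 + 2 * t ^ 2) * (gammaOne (m + 3)).index ≤ (m + 1 + 2 * t ^ 2) * m :=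
    mul_le_mul_of_nonneg_left (by linarith) (by positivity)
  have h4 : t ^ 2 * (m + 1) = t := by rw [pow_two, mul_assoc, htm, mul_one]
  linarith

/-! ### Relabelling and comparison with `Γ₁` -/

theorem exists_equiv_fin_of_ne [Fintype V] {n : ℕ} (hn : Fintype.card V = n)
    {u v w : V} (huv : u ≠ v) (huw : u ≠ w) (hvw : v ≠ w) :
    ∃ f : V ≃ Fin n, (f u).val = 0 ∧ (f v).val = 1 ∧ (f w).val = 2 := by
  classical
  have h3 : 2 < n := by
    rw [← hn, Fintype.two_lt_card_iff]
    exact ⟨u, v, w, huv, huw, hvw⟩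
  let e : V ≃ Fin n := Fintype.equivFinOfCardEq hn
  let e₁ : V ≃ Fin n := e.trans (Equiv.swap (e u) ⟨0, by omega⟩)
  have h₁ : e₁ u = ⟨0, by omega⟩ := by simp [e₁]
  let e₂ : V ≃ Fin n := e₁.trans (Equiv.swap (e₁ v) ⟨1, by omega⟩)
  have h₂v : e₂ v = ⟨1, by omega⟩ := by simp [e₂]
  have h₂u : e₂ u = ⟨0, by omega⟩ := by
    change Equiv.swap _ _ (e₁ u) = _
    rw [Equiv.swap_apply_of_ne_of_ne (e₁.injective.ne huv), h₁]
    rw [h₁]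
    simp
  let e₃ : V ≃ Fin n := e₂.trans (Equiv.swap (e₂ w) ⟨2, by omega⟩)
  have h₃w : e₃ w = ⟨2, by omega⟩ := by simp [e₃]
  have h₃u : e₃ u = ⟨0, by omega⟩ := by
    change Equiv.swap _ _ (e₂ u) = _
    rw [Equiv.swap_apply_of_ne_of_ne (e₂.injective.ne huw), h₂u]
    rw [h₂u]
    simp
  have h₃v : e₃ v = ⟨1, by omega⟩ := by
    change Equiv.swap _ _ (e₂ v) = _
    rw [Equiv.swap_apply_of_ne_of_ne (e₂.injective.ne hvw), h₂v]
    rw [h₂v]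
    simp
  exact ⟨e₃, by rw [h₃u], by rw [h₃v], by rw [h₃w]⟩

theorem adj_iff_adjMatrix_ne_zero (Γ : SignedGraph V) (a b : V) :
    Γ.graph.Adj a b ↔ Γ.adjMatrix a b ≠ 0 := by
  refine ⟨fun e => ?_, fun e => ?_⟩
  · rw [Γ.adjMatrix_of_adj e]
    simp
  · by_contra h
    exact e (Γ.adjMatrix_of_not_adj h)

theorem isomorphic_of_adjMatrix_eq {Γ : SignedGraph V} {Γ' : SignedGraph W} (f : V ≃ W)
    (h : ∀ a b, Γ.adjMatrix a b = Γ'.adjMatrix (f a) (f b)) : Γ.Isomorphic Γ' := by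
  refine ⟨⟨f, fun {a b} => ?_⟩, fun a b e => ?_⟩
  · rw [adj_iff_adjMatrix_ne_zero, adj_iff_adjMatrix_ne_zero, h]
  · have e' : Γ'.graph.Adj (f a) (f b) := by
      rw [adj_iff_adjMatrix_ne_zero, ← h, Γ.adjMatrix_of_adj e]
      simp
    have h1 := h a b
    rw [Γ.adjMatrix_of_adj e, Γ'.adjMatrix_of_adj e'] at h1
    exact Units.ext (by exact_mod_cast h1.symm)

/-- Some switching of `Γ` has an entrywise nonnegative eigenvector for the index, normalized so
that its largest entry is `1`. -/
theorem exists_switch_nonneg_eigenvector [Fintype V] [Nonempty V] (Γ : SignedGraph V) :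
    ∃ (θ : V → ℤˣ) (x : V → ℝ), (∀ a, 0 ≤ x a) ∧ (∀ a, x a ≤ 1) ∧ (∃ m, x m = 1) ∧
      ∀ a, ∑ b, (Γ.switch θ).adjMatrix a b * x b = Γ.index * x a := by
  obtain ⟨y, hy⟩ := Γ.isGreatest_index.1.exists_hasEigenvector
  have hy1 : ∀ a, ∑ b, Γ.adjMatrix a b * y b = Γ.index * y a := fun a =>
    congrFun hy.apply_eq_smul a
  obtain ⟨m, hm⟩ := Finite.exists_max fun a => |y a|
  have hM : 0 < |y m| := by
    rw [abs_pos]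
    intro h0
    refine hy.2 (funext fun a => ?_)
    have := hm a
    rw [h0, abs_zero] at this
    exact abs_nonpos_iff.1 this
  let θ : V → ℤˣ := fun a => if y a < 0 then -1 else 1
  have hθ : ∀ a, |y a| = ((θ a : ℤ) : ℝ) * y a := by
    intro a
    by_cases h : y a < 0
    · simp [θ, h, abs_of_neg]
    · simp [θ, h, abs_of_nonneg (not_lt.1 h)]
  have hθ2 : ∀ a, ((θ a : ℤ) : ℝ) * ((θ a : ℤ) : ℝ) = 1 := by
    intro a
    rcases Int.units_eq_one_or (θ a) with h | h <;> simp [h]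
  refine ⟨θ, fun a => |y a| / |y m|, fun a => by positivity,
    fun a => (div_le_one hM).2 (hm a), ⟨m, div_self hM.ne'⟩, fun a => ?_⟩
  calc ∑ b, (Γ.switch θ).adjMatrix a b * (|y b| / |y m|)
      = ∑ b, ((θ a : ℤ) : ℝ) / |y m| * (Γ.adjMatrix a b * y b) := by
        refine Finset.sum_congr rfl fun b _ => ?_
        rw [adjMatrix_switch, hθ b]
        linear_combination ((θ a : ℤ) : ℝ) * Γ.adjMatrix a b * y b / |y m| * hθ2 b
    _ = Γ.index * (|y a| / |y m|) := by
        rw [← Finset.mul_sum, hy1, hθ a]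
        ring

/-- Equality case of monotonicity: since `A(Γ₁) x ≥ A(Γ) x = lam x ≥ λ₁(Γ₁) x`, the vector `x` is
extremal for `Γ₁` too. So `(A(Γ₁) - A(Γ)) x = 0` with nonnegative terms, and the columns with `x b ≠
0` agree; symmetry covers a zero of `x`. -/
theorem adjMatrix_eq_gammaOne [Fintype V] {Γ : SignedGraph V} {n : ℕ} (hn : 3 ≤ n)
    {x : V → ℝ} {lam : ℝ} (hx0 : ∀ a, 0 ≤ x a) (hpos : ∀ a b, a ≠ b → 0 < x a + x b)
    (heig : ∀ a, ∑ b, Γ.adjMatrix a b * x b = lam * x a)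
    (hlam : (gammaOne n).index ≤ lam) (f : V ≃ Fin n)
    (hle : ∀ a b, Γ.adjMatrix a b ≤ (gammaOne n).adjMatrix (f a) (f b)) (a b : V) :
    Γ.adjMatrix a b = (gammaOne n).adjMatrix (f a) (f b) := by
  have : Nonempty (Fin n) := ⟨⟨0, by omega⟩⟩
  have hsum : ∀ a, ∑ j, (gammaOne n).adjMatrix (f a) j * x (f.symm j) =
      ∑ b, (gammaOne n).adjMatrix (f a) (f b) * x b := fun a => by
    rw [← f.sum_comp]
    simp
  have hrow : ∀ a, lam * x a ≤ ∑ b, (gammaOne n).adjMatrix (f a) (f b) * x b := fun a => by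
    rw [← heig]
    exact Finset.sum_le_sum fun b _ => mul_le_mul_of_nonneg_right (hle a b) (hx0 b)
  have key := (gammaOne n).eigen_of_sum_index_sub_nonpos (z := fun i => x (f.symm i)) (by
    rw [← f.sum_comp]
    simp only [Equiv.symm_apply_apply, hsum]
    refine Finset.sum_nonpos fun a _ => mul_nonpos_of_nonneg_of_nonpos (hx0 a) ?_
    linarith [hrow a, mul_le_mul_of_nonneg_right hlam (hx0 a)])
  have hzero : ∀ a b, x b ≠ 0 → Γ.adjMatrix a b = (gammaOne n).adjMatrix (f a) (f b) := by
    intro a b hb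
    have h1 := key (f a)
    rw [hsum, Equiv.symm_apply_apply] at h1
    have h2 : ∑ b, ((gammaOne n).adjMatrix (f a) (f b) - Γ.adjMatrix a b) * x b = 0 := by
      simp only [sub_mul, Finset.sum_sub_distrib, heig]
      linarith [hrow a, mul_le_mul_of_nonneg_right hlam (hx0 a)]
    rw [Finset.sum_eq_zero_iff_of_nonneg fun b _ =>
      mul_nonneg (sub_nonneg.2 (hle a b)) (hx0 b)] at h2
    have := (mul_eq_zero.1 (h2 b (Finset.mem_univ b))).resolve_right hb
    linarith
  by_cases hab : a = b
  · rw [hab, adjMatrix_diag, adjMatrix_diag]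
  · by_cases hb : x b = 0
    · rw [adjMatrix_symm, adjMatrix_symm (gammaOne n)]
      refine hzero b a fun ha => ?_
      have := hpos a b hab
      rw [ha, hb] at this
      norm_num at this
    · exact hzero a b hb

/-- Off the diagonal, `Γ₁` has entries below 1 only at `uv` and from `u, v` to vertices other than
`w`, where `huv`, `hu` and `hv` give the bound. -/
theorem adjMatrix_le_gammaOne [Fintype V] {Γ : SignedGraph V} {n : ℕ} {u v w : V}
    (huv : Γ.adjMatrix u v = -1) (hu : posNbr Γ.adjMatrix u = {w})
    (hv : posNbr Γ.adjMatrix v = {w}) (f : V ≃ Fin n)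
    (hfu : (f u).val = 0) (hfv : (f v).val = 1) (hfw : (f w).val = 2) (a b : V) :
    Γ.adjMatrix a b ≤ (gammaOne n).adjMatrix (f a) (f b) := by
  have hle1 : ∀ a b, Γ.adjMatrix a b ≤ 1 := fun a b => by
    rcases Γ.adjMatrix_mem a b with h | h | h <;> rw [h] <;> norm_num
  have hle0 : ∀ z, posNbr Γ.adjMatrix z = {w} → ∀ b, b ≠ w → Γ.adjMatrix z b ≤ 0 := by
    intro z hz b hb
    rcases Γ.adjMatrix_mem z b with h | h | h
    · rw [h]; norm_num
    · rw [h]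
    · have hmem := mem_posNbr.2 h
      rw [hz, Finset.mem_singleton] at hmem
      exact absurd hmem hb
  have hval : ∀ a z, (f a).val = (f z).val → a = z := fun a z h => f.injective (Fin.ext h)
  have hlow : ∀ a, (f a).val ≤ 1 → posNbr Γ.adjMatrix a = {w} := by
    intro a ha
    rcases Nat.le_one_iff_eq_zero_or_eq_one.1 ha with h | h
    · rw [hval a u (by omega), hu]
    · rw [hval a v (by omega), hv]
  rw [gammaOne_adjMatrix]
  split_ifs with h1 h2 h3
  · rw [f.injective h1, adjMatrix_diag]
  · have hne : (f a).val ≠ (f b).val := fun h => h1 (Fin.ext h)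
    by_cases ha : (f a).val = 0
    · rw [hval a u (by omega), hval b v (by omega), huv]
    · rw [hval a v (by omega), hval b u (by omega), adjMatrix_symm, huv]
  · exact hle1 a b
  · rcases Nat.lt_or_ge (f a).val 2 with ha | ha
    · exact hle0 a (hlow a (by omega)) b (by rintro rfl; omega)
    · rw [adjMatrix_symm]
      exact hle0 b (hlow b (by omega)) a (by rintro rfl; omega)

end SignedGraph

/-! ### The main theorem -/

open SignedGraph in
theorem mainTheorem2 {V : Type*} [Fintype V] (Γ : SignedGraph V) (n : ℕ)
    (hcard : Fintype.card V = n) (hn : 12 ≤ n) (hunbalanced : ¬ Γ.Balanced)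
    (hindex : (SignedGraph.gammaOne n).index ≤ Γ.index) :
    Γ.HasNegativeCycle 5 ∨ Γ.SwitchingEquiv (SignedGraph.gammaOne n) := by
  classical
  have : Nonempty V := Fintype.card_pos_iff.1 (by omega)
  by_cases h5 : Γ.HasNegativeCycle 5
  · exact Or.inl h5
  refine Or.inr ?_
  obtain ⟨θ, x, hx0, hx1, ⟨m, hm⟩, heig⟩ := Γ.exists_switch_nonneg_eigenvector
  set Δ := Γ.switch θ with hΔ
  have hlam : (Fintype.card V : ℝ) - 3 < Γ.index := by
    rw [hcard]
    exact (lt_index_gammaOne (by omega)).trans_le hindex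
  -- The row of `m`, where `x m = 1`, bounds the index by the sum of the other entries.
  have hS : Γ.index + 1 ≤ ∑ a, x a := by
    have h1 := sum_mul_le_sum_posNbr Δ.adjMatrix_mem hx0 m
    rw [heig, hm, mul_one] at h1
    have h2 : ∑ b ∈ posNbr Δ.adjMatrix m, x b ≤ ∑ b ∈ Finset.univ.erase m, x b :=
      Finset.sum_le_sum_of_subset_of_nonneg (fun b hb => by
        rw [Finset.mem_erase]
        refine ⟨?_, Finset.mem_univ b⟩
        rintro rfl
        have hbb := mem_posNbr.1 hb
        rw [adjMatrix_diag] at hbb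
        norm_num at hbb) fun b _ _ => hx0 b
    have h3 := Finset.add_sum_erase Finset.univ x (Finset.mem_univ m)
    linarith
  have hpos : ∀ a b, a ≠ b → 0 < x a + x b := by
    intro a b hab
    have := sum_one_sub_lt_two hx1 hlam hS {a, b}
    rw [Finset.sum_pair hab] at this
    linarith
  obtain ⟨u, v, huv⟩ := exists_adjMatrix_eq_neg_one fun h : Δ.Balanced =>
    hunbalanced (Balanced.of_switch h)
  obtain ⟨w, hu, hv⟩ := exists_unique_posNbr Δ.adjMatrix_mem Δ.adjMatrix_symm Δ.adjMatrix_diag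
    hx0 hx1 (hcard ▸ hn) hlam hS hpos heig huv
    fun a b c hac hbu hbv h1 h2 h3 h4 =>
      h5 (hasNegativeCycle_five huv hac hbu hbv h1 h2 h3 h4).of_switch
  have huw : Δ.adjMatrix u w = 1 := mem_posNbr.1 (by rw [hu]; simp)
  have hvw : Δ.adjMatrix v w = 1 := mem_posNbr.1 (by rw [hv]; simp)
  have hne : ∀ a b, Δ.adjMatrix a b ≠ 0 → a ≠ b := by
    rintro a b h rfl
    exact h (Δ.adjMatrix_diag a)
  obtain ⟨f, hfu, hfv, hfw⟩ := exists_equiv_fin_of_ne hcard (hne u v (by rw [huv]; norm_num))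
    (hne u w (by rw [huw]; norm_num)) (hne v w (by rw [hvw]; norm_num))
  exact ⟨θ, isomorphic_of_adjMatrix_eq f (adjMatrix_eq_gammaOne (by omega) hx0 hpos heig hindex f
    (adjMatrix_le_gammaOne huv hu hv f hfu hfv hfw))⟩
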